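/- Let $A\in\mathbb{R}^{n\times d}$ and let $S\in\{0,1\}^{n\times d}$ have at most $s$ nonzero entries in each row. Draw a $d\times m$ matrix $G$ with independent standard normal entries and compute $Z=AG$ (that is, $m$ non-adaptive matrix-vector products with $A$). Define $\widetilde A\in\mathbb{R}^{n\times d}$ row by row: with $S_i=\{j: S_{ij}=1\}$, $z_i^{\mathsf T}$ the $i$-th row of $Z$, and $G_i\in\mathbb{R}^{m\times|S_i|}$ the transpose of the submatrix of $G$ formed by the rows with index in $S_i$, put $[\widetilde A]_{i,S_i}=(G_i^\dagger z_i)^{\mathsf T}$ ($\dagger$ is the Moore–Penrose pseudoinverse) and $[\widetilde A]_{i,j}=0$ for $j\notin S_i$. Let $\circ$ be the entrywise product and $\|\cdot\|_F$ the Frobenius norm. (i) For all $\varepsilon>0$ and $\delta\in(0,1)$, if $m\ge s\bigl(\frac{1}{2\delta\varepsilon}+1\bigr)+1$ then $$\mathbb{P}\bigl[\|A-\widetilde A\|_F\ge(1+\varepsilon)\|A-S\circ A\|_F\bigr]\le\delta \quad\text{whenever } A\ne S\circ A,$$ and in every case (also if $A=S\circ A$), except with probability at most $\delta$, $\widetilde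 A$ solves the fixed-sparsity approximation problem with accuracy $\varepsilon$, i.e. $\widetilde A=S\circ\widetilde A$ and $\|A-\widetilde A\|_F\le(1+\varepsilon)\|A-S\circ A\|_F$. (ii) Consequently $O(s/\varepsilon)$ non-adaptive matrix-vector products suffice for any constant success probability: for every $\delta\in(0,1)$ there is a constant $C>0$, depending only on $\delta$, such that for every integer $s\ge 0$ and every $\varepsilon\in(0,1]$ there is an integer $m_0\le C s/\varepsilon$ with the property that, for all $m\ge m_0$, all $n,d$, all $A\in\mathbb{R}^{n\times d}$ and all $S\in\{0,1\}^{n\times d}$ with at most $s$ nonzero entries per row, the matrix $\widetilde A$ above, computed from $m$ products, satisfies $\widetilde A=S\circ\widetilde A$ and $\|A-\widetilde A\|_F\le(1+\varepsilon)\|A-S\circ A\|_F$ except with probability at most $\delta$. -/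

import Mathlib

open MeasureTheory ProbabilityTheory
open scoped Matrix Matrix.Norms.Frobenius

namespace FixedSparsity

section Pseudoinverse

variable {k l : Type*} [Fintype k]

theorem gram_isHermitian (M : Matrix k l ℝ) : (Mᵀ * M).IsHermitian := by
  simpa using Matrix.isHermitian_conjTranspose_mul_self M

variable [Fintype l]

/-- The Penrose equations: `X` is the Moore–Penrose pseudoinverse of the real matrix `M`. -/
structure IsMoorePenrose (M : Matrix k l ℝ) (X : Matrix l k ℝ) : Prop where
  mul_mul_self : M * X * M = M
  self_mul_mul : X * M * X = X
  symm_left : (M * X)ᵀ = M * X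
  symm_right : (X * M)ᵀ = X * M

variable [DecidableEq l]

/-- The pseudoinverse of the Gram matrix `Mᵀ M = U diag(μ) Uᵀ`, namely `U diag(μ⁺) Uᵀ` with
`μ⁺ = 1/μ` for `μ ≠ 0` and `0⁺ = 0` (which is Lean's convention for `0⁻¹`). -/
noncomputable def gramPinv (M : Matrix k l ℝ) : Matrix l l ℝ :=
  ((gram_isHermitian M).eigenvectorUnitary : Matrix l l ℝ)
    * Matrix.diagonal (fun i => ((gram_isHermitian M).eigenvalues i)⁻¹)
    * ((gram_isHermitian M).eigenvectorUnitary : Matrix l l ℝ)ᵀ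

/-- The Moore–Penrose pseudoinverse `M† = (Mᵀ M)† Mᵀ` of a real matrix. -/
noncomputable def pinv (M : Matrix k l ℝ) : Matrix l k ℝ := gramPinv M * Mᵀ

theorem gramPinv_spec (M : Matrix k l ℝ) :
    (gramPinv M)ᵀ = gramPinv M ∧
    gramPinv M * (Mᵀ * M) = (Mᵀ * M) * gramPinv M ∧
    (Mᵀ * M) * gramPinv M * (Mᵀ * M) = Mᵀ * M ∧
    gramPinv M * (Mᵀ * M) * gramPinv M = gramPinv M := by
  have hU : ((gram_isHermitian M).eigenvectorUnitary : Matrix l l ℝ)ᵀ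
      * ((gram_isHermitian M).eigenvectorUnitary : Matrix l l ℝ) = 1 := by
    have h := Unitary.coe_star_mul_self (gram_isHermitian M).eigenvectorUnitary
    rwa [Matrix.star_eq_conjTranspose, Matrix.conjTranspose_eq_transpose_of_trivial] at h
  have hH : Mᵀ * M = ((gram_isHermitian M).eigenvectorUnitary : Matrix l l ℝ)
      * Matrix.diagonal (fun i => (gram_isHermitian M).eigenvalues i)
      * ((gram_isHermitian M).eigenvectorUnitary : Matrix l l ℝ)ᵀ := by
    have h := (gram_isHermitian M).spectral_theorem
    rw [Unitary.conjStarAlgAut_apply, Matrix.star_eq_conjTranspose,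
      Matrix.conjTranspose_eq_transpose_of_trivial] at h
    exact h
  unfold gramPinv
  generalize ((gram_isHermitian M).eigenvectorUnitary : Matrix l l ℝ) = U at hU hH ⊢
  generalize (gram_isHermitian M).eigenvalues = μ at hH ⊢
  have key : ∀ D E : Matrix l l ℝ, (U * D * Uᵀ) * (U * E * Uᵀ) = U * (D * E) * Uᵀ := by
    intro D E
    calc (U * D * Uᵀ) * (U * E * Uᵀ) = U * D * (Uᵀ * U) * E * Uᵀ := by
          simp only [Matrix.mul_assoc]
      _ = _ := by rw [hU]; simp only [Matrix.mul_assoc, Matrix.mul_one]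
  rw [hH]
  refine ⟨?_, ?_, ?_, ?_⟩
  · simp [Matrix.transpose_mul, Matrix.mul_assoc]
  · rw [key, key, Matrix.diagonal_mul_diagonal, Matrix.diagonal_mul_diagonal]
    simp only [mul_comm]
  · rw [key, key, Matrix.diagonal_mul_diagonal, Matrix.diagonal_mul_diagonal]
    simp only [mul_inv_mul_cancel]
  · rw [key, key, Matrix.diagonal_mul_diagonal, Matrix.diagonal_mul_diagonal]
    congr; funext i
    by_cases h : μ i = 0
    · simp [h]
    · field_simp

/-- `pinv M` satisfies the Penrose equations. -/
theorem pinv_isMoorePenrose (M : Matrix k l ℝ) : IsMoorePenrose M (pinv M) := by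
  obtain ⟨h1, h2, h3, h4⟩ := gramPinv_spec M
  unfold pinv
  generalize gramPinv M = P at h1 h2 h3 h4
  refine ⟨?_, ?_, ?_, ?_⟩
  · have h0 : (M * (P * (Mᵀ * M) - 1))ᵀ * (M * (P * (Mᵀ * M) - 1)) = 0 := by
      have : (Mᵀ * M) * (P * (Mᵀ * M) - 1) = 0 := by
        rw [Matrix.mul_sub, ← Matrix.mul_assoc, h3, Matrix.mul_one, sub_self]
      rw [Matrix.transpose_mul, Matrix.mul_assoc, ← Matrix.mul_assoc Mᵀ, this, Matrix.mul_zero]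
    rw [← Matrix.conjTranspose_eq_transpose_of_trivial,
      Matrix.conjTranspose_mul_self_eq_zero] at h0
    rw [Matrix.mul_sub, Matrix.mul_one, sub_eq_zero] at h0
    simpa only [Matrix.mul_assoc] using h0
  · simpa only [Matrix.mul_assoc] using congrArg (· * Mᵀ) h4
  · simp only [Matrix.transpose_mul, Matrix.transpose_transpose, h1, Matrix.mul_assoc]
  · rw [Matrix.mul_assoc, Matrix.transpose_mul, h1, h2, Matrix.transpose_mul,
      Matrix.transpose_transpose]

/-- The Penrose equations determine the pseudoinverse. -/
theorem IsMoorePenrose.eq_pinv {M : Matrix k l ℝ} {X : Matrix l k ℝ} (h : IsMoorePenrose M X) :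
    X = pinv M := by
  have h' := pinv_isMoorePenrose M
  generalize pinv M = Y at h' ⊢
  have e1 : M * X = M * Y := by
    calc M * X = (M * Y * M) * X := by rw [h'.mul_mul_self]
      _ = (M * Y)ᵀ * (M * X)ᵀ := by rw [h'.symm_left, h.symm_left, Matrix.mul_assoc (M * Y)]
      _ = (M * X * M * Y)ᵀ := by rw [← Matrix.transpose_mul]; simp only [Matrix.mul_assoc]
      _ = M * Y := by rw [h.mul_mul_self, h'.symm_left]
  have e2 : X * M = Y * M := by
    calc X * M = X * (M * Y * M) := by rw [h'.mul_mul_self]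
      _ = (X * M)ᵀ * (Y * M)ᵀ := by
          rw [h'.symm_right, h.symm_right]; simp only [Matrix.mul_assoc]
      _ = (Y * (M * X * M))ᵀ := by rw [← Matrix.transpose_mul]; simp only [Matrix.mul_assoc]
      _ = Y * M := by rw [h.mul_mul_self, h'.symm_right]
  calc X = X * M * X := h.self_mul_mul.symm
    _ = Y * (M * X) := by rw [e2, Matrix.mul_assoc]
    _ = Y := by rw [e1, ← Matrix.mul_assoc, h'.self_mul_mul]

end Pseudoinverse

/-- Matrices carry the product (equivalently, Borel) σ-algebra of their entries. -/
instance instMeasurableSpaceMatrix (d m : ℕ) : MeasurableSpace (Matrix (Fin d) (Fin m) ℝ) :=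
  inferInstanceAs (MeasurableSpace (Fin d → Fin m → ℝ))

/-- The distribution `Gaussian(d, m)` of a `d × m` matrix with independent standard normal
entries. -/
noncomputable def gaussianMatrix (d m : ℕ) : Measure (Matrix (Fin d) (Fin m) ℝ) :=
  Measure.pi (fun _ : Fin d => Measure.pi (fun _ : Fin m => gaussianReal 0 1))

instance instIsProbabilityMeasureGaussianMatrix (d m : ℕ) :
    IsProbabilityMeasure (gaussianMatrix d m) := by
  exact inferInstanceAs (IsProbabilityMeasure
    (Measure.pi (fun _ : Fin d => Measure.pi (fun _ : Fin m => gaussianReal 0 1))))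

/-- A randomized non-adaptive algorithm that uses `m` matrix-vector products with an unknown
`n × d` matrix `A` and returns an `n × d` matrix. The `m` query vectors are the columns of a random
`d × m` matrix `G`, whose law does not depend on `A`; the output is computed from `G` and from the
answers, which are the columns of the `n × m` matrix `Z = A G`. -/
structure NonadaptiveMatvecAlgorithm (n d m : ℕ) where
  queryLaw : Measure (Matrix (Fin d) (Fin m) ℝ)
  isProbabilityMeasure_queryLaw : IsProbabilityMeasure queryLaw
  output : Matrix (Fin d) (Fin m) ℝ → Matrix (Fin n) (Fin m) ℝ → Matrix (Fin n) (Fin d) ℝ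

/-- The matrix returned on input `A` when the query matrix is `G`. -/
def NonadaptiveMatvecAlgorithm.run {n d m : ℕ} (alg : NonadaptiveMatvecAlgorithm n d m)
    (A : Matrix (Fin n) (Fin d) ℝ) (G : Matrix (Fin d) (Fin m) ℝ) : Matrix (Fin n) (Fin d) ℝ :=
  alg.output G (A * G)

/-- `S` is a sparsity pattern, i.e. a matrix in `{0,1}^{n × d}`, with at most `s` nonzero entries
in each row. -/
def IsRowSparsePattern {n d : ℕ} (s : ℕ) (S : Matrix (Fin n) (Fin d) ℝ) : Prop :=
  (∀ i j, S i j = 0 ∨ S i j = 1) ∧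
    ∀ i, (Finset.univ.filter (fun j => S i j ≠ 0)).card ≤ s

/-- The `m × |S_i|` matrix `G_i` with `G_iᵀ = [G]_{S_i, :}`, where `S_i = {j | S i j = 1}`. -/
def rowFactor {n d m : ℕ} (S : Matrix (Fin n) (Fin d) ℝ) (G : Matrix (Fin d) (Fin m) ℝ)
    (i : Fin n) : Matrix (Fin m) {j : Fin d // S i j = 1} ℝ :=
  (G.submatrix Subtype.val id)ᵀ

/-- The matrix `Ã` computed row by row from `G` and `Z`: the `i`-th row is `G_i† z_i` on `S_i` and
zero off `S_i`, where `z_i` is the `i`-th row of `Z`. -/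
noncomputable def recoverRows {n d m : ℕ} (S : Matrix (Fin n) (Fin d) ℝ)
    (G : Matrix (Fin d) (Fin m) ℝ) (Z : Matrix (Fin n) (Fin m) ℝ) : Matrix (Fin n) (Fin d) ℝ :=
  Matrix.of fun i j => if h : S i j = 1 then (pinv (rowFactor S G i) *ᵥ Z i) ⟨j, h⟩ else 0

/-- The fixed-sparse-matrix recovery algorithm: Gaussian queries, then row-wise least squares. -/
noncomputable def fixedSparseRecovery {n d : ℕ} (S : Matrix (Fin n) (Fin d) ℝ) (m : ℕ) :
    NonadaptiveMatvecAlgorithm n d m where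
  queryLaw := gaussianMatrix d m
  isProbabilityMeasure_queryLaw := inferInstance
  output := recoverRows S

/-- `B` solves the fixed-sparsity approximation problem for `A` and the pattern `S` with accuracy
`ε`: it has sparsity `S` and its Frobenius-norm error is at most `(1 + ε)` times the optimal one. -/
def IsNearOptimal {n d : ℕ} (S A : Matrix (Fin n) (Fin d) ℝ) (ε : ℝ)
    (B : Matrix (Fin n) (Fin d) ℝ) : Prop :=
  B = S ⊙ B ∧ ‖A - B‖ ≤ (1 + ε) * ‖A - S ⊙ A‖

end FixedSparsity

/-! Fix a row of `A`, and let `k ≤ s` be the size of its pattern. When the selected rows of `G` are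
independent, the pseudoinverse is a left inverse, so the recovered row is exact on the pattern up to
the image of the noise `∑ a_l G_l` over `l` off the pattern. Off the pattern the error is that of `S
⊙ A`. By Pythagoras the squared error is `‖A - S ⊙ A‖ ^ 2` plus an excess
(`norm_sub_recoverRows_sq`).

The noise is independent of the selected rows. Given these, the excess of the row has mean equal to
the squared Frobenius norm of the left inverse times the squared off-pattern mass
(`lintegral_rowExcess_le`). Row `j` of the left inverse has norm `1 / dist`, where `dist` is the
distance from column `j` to the span of the other columns (`sum_sq_leftInverse_le`). That column is
an independent Gaussian vector, so `dist ^ 2` is chi-squared with almost surely `m - k + 1` degrees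
of freedom, and its inverse has mean `1 / (m - k - 1)` (`lintegral_inv_sum_sq`). Hence the mean
excess is at most `s / (m - s - 1) * ‖A - S ⊙ A‖ ^ 2`.

Failure forces the excess to be at least `2 * ε * ‖A - S ⊙ A‖ ^ 2`, and Markov's inequality gives
the bound on `m`. -/

namespace FixedSparsity

/-! ### Moments of Gaussian vectors and their projections -/

section GaussianMoments

open Real Set

/-- Writes `1 / q` as a mixture of exponentials, which factor over independent coordinates when `q`
is a sum of squares. At `q = 0` both sides are `⊤`. -/
theorem lintegral_exp_neg_mul_Ioi {q : ℝ} (hq : 0 ≤ q) :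
    ∫⁻ t in Ioi (0 : ℝ), ENNReal.ofReal (rexp (-t * q)) = (ENNReal.ofReal q)⁻¹ := by
  rcases hq.eq_or_lt with rfl | hq
  · simp
  · have h := integral_exp_mul_Ioi (a := -q) (by linarith) 0
    have hi := integrableOn_exp_mul_Ioi (a := -q) (by linarith) 0
    have e : ∀ t : ℝ, -t * q = -q * t := fun t => by ring
    simp_rw [e]
    rw [← ofReal_integral_eq_lintegral_ofReal hi (ae_of_all _ fun _ => (exp_pos _).le), h,
      ← ENNReal.ofReal_inv_of_pos hq]
    congr 1
    simp [neg_div, div_neg]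

theorem lintegral_exp_neg_mul_sq_gaussianReal {t : ℝ} (ht : 0 < t) :
    ∫⁻ x, ENNReal.ofReal (rexp (-t * x ^ 2)) ∂gaussianReal 0 1
      = ENNReal.ofReal ((1 + 2 * t) ^ (-(1 / 2) : ℝ)) := by
  have hb : 0 < t + 1 / 2 := by linarith
  rw [gaussianReal_of_var_ne_zero _ one_ne_zero,
    lintegral_withDensity_eq_lintegral_mul _ (by fun_prop) (by fun_prop)]
  have e : ∀ x : ℝ, (gaussianPDF 0 1 * fun x => ENNReal.ofReal (rexp (-t * x ^ 2))) x
      = ENNReal.ofReal ((√(2 * π))⁻¹ * rexp (-(t + 1 / 2) * x ^ 2)) := by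
    intro x
    rw [Pi.mul_apply, gaussianPDF, gaussianPDFReal, ← ENNReal.ofReal_mul (by positivity)]
    congr 1
    rw [mul_assoc, ← Real.exp_add]
    simp only [NNReal.coe_one, mul_one, sub_zero]
    congr 2
    ring
  simp_rw [e]
  rw [← ofReal_integral_eq_lintegral_ofReal
    ((integrable_exp_neg_mul_sq hb).const_mul _) (ae_of_all _ fun _ => by positivity),
    integral_const_mul, integral_gaussian, ← Real.sqrt_inv, ← Real.sqrt_mul (by positivity),
    Real.rpow_neg (by linarith), ← Real.sqrt_eq_rpow, ← Real.sqrt_inv]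
  congr 2
  field_simp
  ring

theorem lintegral_rpow_Ioi {p : ℝ} (hp : 1 < p) :
    ∫⁻ t in Ioi (0 : ℝ), ENNReal.ofReal ((1 + 2 * t) ^ (-p)) = ENNReal.ofReal (1 / (2 * p - 2)) := by
  have hd : ∀ x ∈ Ici (0 : ℝ), HasDerivAt (fun t : ℝ => -(1 / (2 * p - 2)) * (1 + 2 * t) ^ (1 - p))
      ((1 + 2 * x) ^ (-p)) x := by
    intro x hx
    have hx' : (0 : ℝ) ≤ x := hx
    have h1 : HasDerivAt (fun t : ℝ => 1 + 2 * t) 2 x := by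
      simpa using ((hasDerivAt_id x).const_mul 2).const_add 1
    have h2 := (h1.rpow_const (p := 1 - p) (Or.inl (by positivity))).const_mul (-(1 / (2 * p - 2)))
    have hp' : p - 1 ≠ 0 := by linarith
    refine h2.congr_deriv ?_
    rw [show 1 - p - 1 = -p by ring, show 2 * p - 2 = 2 * (p - 1) by ring]
    field_simp
    ring
  have hl : Filter.Tendsto (fun t : ℝ => -(1 / (2 * p - 2)) * (1 + 2 * t) ^ (1 - p)) Filter.atTop
      (nhds 0) := by
    rw [← mul_zero (-(1 / (2 * p - 2)))]
    refine Filter.Tendsto.const_mul _ ?_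
    have h := tendsto_rpow_neg_atTop (y := p - 1) (by linarith)
    rw [neg_sub] at h
    exact h.comp (Filter.tendsto_atTop_add_const_left _ _
      (Filter.tendsto_id.const_mul_atTop (by norm_num)))
  have hn : ∀ x ∈ Ioi (0 : ℝ), 0 ≤ (1 + 2 * x) ^ (-p) := fun x hx => by
    have hx' : (0 : ℝ) < x := hx
    positivity
  have hi := integrableOn_Ioi_deriv_of_nonneg' hd hn hl
  have h := integral_Ioi_of_hasDerivAt_of_nonneg' hd hn hl
  rw [← ofReal_integral_eq_lintegral_ofReal hi
    ((ae_restrict_iff' measurableSet_Ioi).2 (ae_of_all _ hn)), h]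
  simp

/-- The inverse of a chi-squared variable with `ν ≥ 3` degrees of freedom has mean
`1 / (ν - 2)`. -/
theorem lintegral_inv_sum_sq {ι : Type*} [Fintype ι] (h3 : 3 ≤ Fintype.card ι) :
    ∫⁻ x : ι → ℝ, (ENNReal.ofReal (∑ i, x i ^ 2))⁻¹ ∂Measure.pi (fun _ => gaussianReal 0 1)
      = ENNReal.ofReal (1 / ((Fintype.card ι : ℝ) - 2)) := by
  have h3' : (3 : ℝ) ≤ Fintype.card ι := by exact_mod_cast h3
  have e : ∀ x : ι → ℝ, (ENNReal.ofReal (∑ i, x i ^ 2))⁻¹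
      = ∫⁻ t in Ioi (0 : ℝ), ENNReal.ofReal (rexp (-t * ∑ i, x i ^ 2)) := fun x =>
    (lintegral_exp_neg_mul_Ioi (Finset.sum_nonneg fun i _ => sq_nonneg _)).symm
  simp_rw [e]
  -- By Tonelli the expectation goes inside; independence turns it into a product of `ν` factors `(1
  -- + 2 * t) ^ (-1 / 2)`.
  rw [lintegral_lintegral_swap (by fun_prop)]
  have e2 : ∀ t ∈ Ioi (0 : ℝ), ∫⁻ x : ι → ℝ, ENNReal.ofReal (rexp (-t * ∑ i, x i ^ 2))
        ∂Measure.pi (fun _ => gaussianReal 0 1)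
      = ENNReal.ofReal ((1 + 2 * t) ^ (-((Fintype.card ι : ℝ) / 2))) := by
    intro t ht
    have ht' : (0 : ℝ) < t := ht
    simp_rw [Finset.mul_sum, Real.exp_sum,
      ENNReal.ofReal_prod_of_nonneg (fun i _ => (exp_pos _).le)]
    have hm : Measurable fun y : ℝ => ENNReal.ofReal (rexp (-t * y ^ 2)) := by fun_prop
    rw [lintegral_prod_eq_prod_lintegral_of_indepFun _
      (fun i (x : ι → ℝ) => ENNReal.ofReal (rexp (-t * x i ^ 2)))
      (iIndepFun_pi (X := fun _ y => ENNReal.ofReal (rexp (-t * y ^ 2))) fun _ => hm.aemeasurable)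
      fun i => hm.comp (measurable_pi_apply i)]
    have e1 : ∀ i, ∫⁻ x : ι → ℝ, ENNReal.ofReal (rexp (-t * x i ^ 2))
        ∂Measure.pi (fun _ => gaussianReal 0 1)
        = ENNReal.ofReal ((1 + 2 * t) ^ (-(1 / 2) : ℝ)) := fun i => by
      rw [← lintegral_exp_neg_mul_sq_gaussianReal ht']
      exact (measurePreserving_eval (fun _ : ι => gaussianReal 0 1) i).lintegral_comp hm
    simp_rw [e1]
    rw [Finset.prod_const, ← ENNReal.ofReal_pow (by positivity), ← Real.rpow_mul_natCast (by positivity)]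
    congr 2
    simp only [Finset.card_univ]
    ring
  rw [setLIntegral_congr_fun measurableSet_Ioi e2, lintegral_rpow_Ioi (by linarith)]
  congr 2
  ring

variable {E : Type*} [NormedAddCommGroup E] [InnerProductSpace ℝ E] [FiniteDimensional ℝ E]
  [MeasurableSpace E] [BorelSpace E]

theorem lintegral_inv_norm_sq_stdGaussian (h3 : 3 ≤ Module.finrank ℝ E) :
    ∫⁻ x : E, (ENNReal.ofReal (‖x‖ ^ 2))⁻¹ ∂stdGaussian E
      = ENNReal.ofReal (1 / ((Module.finrank ℝ E : ℝ) - 2)) := by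
  rw [stdGaussian, lintegral_map (by fun_prop) (by fun_prop)]
  have e : ∀ x : Fin (Module.finrank ℝ E) → ℝ,
      ‖∑ i, x i • stdOrthonormalBasis ℝ E i‖ ^ 2 = ∑ i, x i ^ 2 := by
    intro x
    rw [← real_inner_self_eq_norm_sq, (stdOrthonormalBasis ℝ E).orthonormal.inner_sum]
    simp [sq]
  simp_rw [e]
  rw [lintegral_inv_sum_sq (by simpa using h3)]
  simp

/-- The projection is self-adjoint and fixes `K`, so both characteristic functions at `t ∈ K` equal
that of the ambient Gaussian at `t`. -/
theorem map_orthogonalProjection_stdGaussian (K : Submodule ℝ E) :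
    (stdGaussian E).map K.orthogonalProjectionOnto = stdGaussian K := by
  apply Measure.ext_of_charFun
  ext t
  rw [charFun_stdGaussian, charFun_apply, integral_map (by fun_prop) (by fun_prop)]
  have e : ∀ x : E, inner ℝ (K.orthogonalProjectionOnto x) t = inner ℝ x (t : E) := by
    intro x
    rw [Submodule.coe_inner, ← Submodule.starProjection_apply,
      Submodule.inner_starProjection_left_eq_right, Submodule.starProjection_eq_self_iff.2 t.2]
  simp_rw [e]
  rw [← charFun_apply, charFun_stdGaussian]
  simp

theorem lintegral_inv_norm_sq_starProjection (K : Submodule ℝ E) (h3 : 3 ≤ Module.finrank ℝ K) :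
    ∫⁻ x : E, (ENNReal.ofReal (‖K.starProjection x‖ ^ 2))⁻¹ ∂stdGaussian E
      = ENNReal.ofReal (1 / ((Module.finrank ℝ K : ℝ) - 2)) := by
  rw [← lintegral_inv_norm_sq_stdGaussian h3, ← map_orthogonalProjection_stdGaussian,
    lintegral_map (by fun_prop) (by fun_prop)]
  rfl

/-- Variances of independent variables add. The conclusion repeats the hypotheses (square
integrable, centred) for the sum, so that the lemma can be applied within each row and then across
rows. -/
theorem integral_sq_sum_pi {ι Ω : Type*} [Fintype ι] [MeasurableSpace Ω] (μ : Measure Ω)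
    [IsProbabilityMeasure μ] (X : ι → Ω → ℝ) (hX : ∀ i, MemLp (X i) 2 μ)
    (h0 : ∀ i, ∫ ω, X i ω ∂μ = 0) :
    MemLp (fun ω : ι → Ω => ∑ i, X i (ω i)) 2 (Measure.pi fun _ => μ) ∧
    ∫ ω : ι → Ω, ∑ i, X i (ω i) ∂Measure.pi (fun _ => μ) = 0 ∧
    ∫ ω : ι → Ω, (∑ i, X i (ω i)) ^ 2 ∂Measure.pi (fun _ => μ) = ∑ i, ∫ ω, X i ω ^ 2 ∂μ := by
  have hm : ∀ i, MemLp (fun ω : ι → Ω => X i (ω i)) 2 (Measure.pi fun _ => μ) := fun i =>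
    (hX i).comp_measurePreserving (measurePreserving_eval (fun _ => μ) i)
  have hL : MemLp (fun ω : ι → Ω => ∑ i, X i (ω i)) 2 (Measure.pi fun _ => μ) :=
    memLp_finsetSum _ fun i _ => hm i
  have hi : ∫ ω : ι → Ω, ∑ i, X i (ω i) ∂Measure.pi (fun _ => μ) = 0 := by
    rw [integral_finsetSum _ fun i _ => (hm i).integrable one_le_two]
    refine Finset.sum_eq_zero fun i _ => ?_
    rw [integral_comp_eval (hX i).aestronglyMeasurable, h0]
  refine ⟨hL, hi, ?_⟩
  have hv := variance_sum_pi (μ := fun _ : ι => μ) hX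
  have e : (∑ i, fun ω : ι → Ω => X i (ω i)) = fun ω => ∑ i, X i (ω i) := by
    ext ω
    simp
  rw [e, variance_of_integral_eq_zero hL.aestronglyMeasurable.aemeasurable hi] at hv
  rw [hv]
  exact Finset.sum_congr rfl fun i _ =>
    variance_of_integral_eq_zero (hX i).aestronglyMeasurable.aemeasurable (h0 i)

theorem lintegral_sq_linear_gaussianMatrix {d m : ℕ} (c : Fin d → Fin m → ℝ) :
    ∫⁻ G, ENNReal.ofReal ((∑ l, ∑ p, c l p * G l p) ^ 2) ∂gaussianMatrix d m
      = ENNReal.ofReal (∑ l, ∑ p, c l p ^ 2) := by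
  have h1 : ∀ a : ℝ, MemLp (fun x : ℝ => a * x) 2 (gaussianReal 0 1) := fun a =>
    (memLp_id_gaussianReal 2).const_mul a
  have h2 : ∀ a : ℝ, ∫ x : ℝ, a * x ∂gaussianReal 0 1 = 0 := fun a => by
    rw [integral_const_mul, integral_id_gaussianReal, mul_zero]
  have h3 : ∀ a : ℝ, ∫ x : ℝ, (a * x) ^ 2 ∂gaussianReal 0 1 = a ^ 2 := fun a => by
    have hv := variance_fun_id_gaussianReal (μ := 0) (v := 1)
    rw [variance_of_integral_eq_zero (by fun_prop) integral_id_gaussianReal] at hv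
    simp_rw [mul_pow]
    rw [integral_const_mul, hv]
    simp
  have hr := fun l => integral_sq_sum_pi (gaussianReal 0 1) (fun p x => c l p * x)
    (fun p => h1 (c l p)) (fun p => h2 (c l p))
  have hc := integral_sq_sum_pi (Measure.pi fun _ : Fin m => gaussianReal 0 1)
    (fun l (g : Fin m → ℝ) => ∑ p, c l p * g p) (fun l => (hr l).1) (fun l => (hr l).2.1)
  simp_rw [(hr _).2.2, h3] at hc
  rw [← hc.2.2]
  exact (ofReal_integral_eq_lintegral_ofReal hc.1.integrable_sq
    (ae_of_all _ fun _ => sq_nonneg _)).symm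

end GaussianMoments

/-! ### The left inverse and distances between columns -/

section LeastSquares

variable {k l : Type*} [Fintype k] [Fintype l] [DecidableEq l]

/-- `Mᵀ * M` and `M` have the same kernel. -/
theorem isUnit_det_gram_iff (M : Matrix k l ℝ) :
    IsUnit (Mᵀ * M).det ↔ LinearIndependent ℝ (fun j => WithLp.toLp 2 (Mᵀ j)) := by
  rw [← Matrix.isUnit_iff_isUnit_det, ← Matrix.mulVec_injective_iff_isUnit]
  have e : Function.Injective (Mᵀ * M).mulVec ↔ Function.Injective M.mulVec := by
    have hk := Matrix.ker_mulVecLin_transpose_mul_self M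
    constructor
    · intro h
      have := LinearMap.ker_eq_bot.2 (show Function.Injective (Mᵀ * M).mulVecLin from h)
      rw [hk] at this
      exact LinearMap.ker_eq_bot.1 this
    · intro h
      have := LinearMap.ker_eq_bot.2 (show Function.Injective M.mulVecLin from h)
      rw [← hk] at this
      exact LinearMap.ker_eq_bot.1 this
  rw [e, Matrix.mulVec_injective_iff]
  exact ((WithLp.linearEquiv 2 ℝ (k → ℝ)).symm.toLinearMap.linearIndependent_iff
    (LinearEquiv.ker _)).symm

/-- The left inverse `(Mᵀ M)⁻¹ Mᵀ` of a matrix with linearly independent columns. -/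
noncomputable def leftInverse (M : Matrix k l ℝ) : Matrix l k ℝ := (Mᵀ * M)⁻¹ * Mᵀ

theorem leftInverse_mul_self {M : Matrix k l ℝ} (h : IsUnit (Mᵀ * M).det) :
    leftInverse M * M = 1 := by
  rw [leftInverse, Matrix.mul_assoc, Matrix.nonsing_inv_mul _ h]

theorem pinv_eq_of_isUnit_det {M : Matrix k l ℝ} (h : IsUnit (Mᵀ * M).det) :
    pinv M = leftInverse M := by
  unfold leftInverse
  refine (IsMoorePenrose.eq_pinv ⟨?_, ?_, ?_, ?_⟩).symm
  · rw [Matrix.mul_assoc, Matrix.mul_assoc, Matrix.nonsing_inv_mul _ h, Matrix.mul_one]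
  · rw [Matrix.mul_assoc _ Mᵀ, Matrix.nonsing_inv_mul _ h, Matrix.one_mul]
  · simp [Matrix.transpose_nonsing_inv, Matrix.mul_assoc]
  · rw [Matrix.mul_assoc, Matrix.nonsing_inv_mul _ h, Matrix.transpose_one]

/-- A row of the left inverse `(Mᵀ M)⁻¹ Mᵀ` has norm at most the inverse of the distance from the
corresponding column of `M` to the span of the other columns. -/
theorem sum_sq_leftInverse_le (M : Matrix k l ℝ) (j : l) (K : Submodule ℝ (EuclideanSpace ℝ k))
    (hK : K = (Submodule.span ℝ ((fun i => WithLp.toLp 2 (Mᵀ i)) '' {j}ᶜ))ᗮ) :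
    ENNReal.ofReal (∑ p, leftInverse M j p ^ 2)
      ≤ (ENNReal.ofReal (‖K.starProjection (WithLp.toLp 2 (Mᵀ j))‖ ^ 2))⁻¹ := by
  unfold leftInverse
  by_cases h : IsUnit (Mᵀ * M).det
  swap
  -- A singular Gram matrix has inverse `0` by convention, so the left side vanishes.
  · simp [Matrix.nonsing_inv_apply_not_isUnit _ h]
  set N := (Mᵀ * M)⁻¹ with hN
  have hBM : N * Mᵀ * M = 1 := by rw [Matrix.mul_assoc, Matrix.nonsing_inv_mul _ h]
  set v : l → EuclideanSpace ℝ k := fun i => WithLp.toLp 2 (Mᵀ i) with hv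
  set r : EuclideanSpace ℝ k := WithLp.toLp 2 ((N * Mᵀ) j) with hr
  -- The rows of the left inverse are dual to the columns of `M`: `r` is orthogonal to every column
  -- but the `j`-th, so it lies in `K`.
  have hrv : ∀ i, inner ℝ (v i) r = (1 : Matrix l l ℝ) j i := by
    intro i
    rw [← hBM]
    simp [hv, hr, PiLp.inner_apply, Matrix.mul_apply (M := N * Mᵀ)]
  have hrK : r ∈ K := by
    rw [hK, Submodule.mem_orthogonal]
    intro u hu
    induction hu using Submodule.span_induction with
    | mem x hx =>
      obtain ⟨i, hi, rfl⟩ := hx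
      rw [hrv, Matrix.one_apply_ne]
      exact fun e => hi e.symm
    | zero => simp
    | add x y _ _ hx hy => rw [inner_add_left, hx, hy, add_zero]
    | smul a x _ hx => rw [inner_smul_left, hx, mul_zero]
  have hrsum : r = ∑ i, N j i • v i := by
    ext p
    simp [hr, hv, Matrix.mul_apply]
  set u := K.starProjection (v j) with hu
  have hru : r = N j j • u := by
    -- Since `r` is also a combination of the columns, projecting it onto `K` leaves only the `j`-th
    -- term.
    rw [← Submodule.starProjection_eq_self_iff.2 hrK, hrsum, map_sum, Finset.sum_eq_single j]
    · rw [map_smul]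
    · intro i _ hi
      rw [map_smul, (Submodule.starProjection_apply_eq_zero_iff K).2, smul_zero]
      rw [hK]
      exact Submodule.le_orthogonal_orthogonal _ (Submodule.subset_span ⟨i, hi, rfl⟩)
    · simp
  have huv : inner ℝ u r = 1 := by
    rw [hu, Submodule.inner_starProjection_left_eq_right,
      Submodule.starProjection_eq_self_iff.2 hrK, hrv, Matrix.one_apply_eq]
  have hc : N j j * ‖u‖ ^ 2 = 1 := by
    rw [hru, inner_smul_right, real_inner_self_eq_norm_sq] at huv
    exact huv
  have hpos : 0 < ‖u‖ ^ 2 := by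
    refine lt_of_le_of_ne (sq_nonneg _) fun e => ?_
    rw [← e, mul_zero] at hc
    exact zero_ne_one hc
  have hnorm : ∑ p, (N * Mᵀ) j p ^ 2 = (‖u‖ ^ 2)⁻¹ := by
    have : ∑ p, (N * Mᵀ) j p ^ 2 = ‖r‖ ^ 2 := by
      rw [EuclideanSpace.real_norm_sq_eq]
    rw [this, hru, norm_smul, mul_pow, Real.norm_eq_abs, sq_abs, eq_inv_of_mul_eq_one_left hc]
    field_simp
  rw [hnorm, ENNReal.ofReal_inv_of_pos hpos]

/-- By Cramer's rule the entries are polynomials in the entries of `F x` divided by a determinant.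
Working with `leftInverse` avoids any measurability question for the eigenvectors inside `pinv`. -/
theorem measurable_leftInverse_apply {α : Type*} [MeasurableSpace α] {F : α → Matrix k l ℝ}
    (hF : ∀ i j, Measurable fun x => F x i j) (j : l) (p : k) :
    Measurable fun x => leftInverse (F x) j p := by
  have hg : ∀ i j, Measurable fun x => ((F x)ᵀ * F x) i j := by
    intro i j
    simp only [Matrix.mul_apply, Matrix.transpose_apply]
    fun_prop
  have hdet : ∀ {H : α → Matrix l l ℝ}, (∀ i j, Measurable fun x => H x i j) →
      Measurable fun x => (H x).det := by
    intro H hH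
    simp only [Matrix.det_apply]
    fun_prop
  have hadj : ∀ i j, Measurable fun x => ((F x)ᵀ * F x).adjugate i j := by
    intro i j
    simp only [Matrix.adjugate_apply]
    refine hdet fun a b => ?_
    by_cases hab : a = j
    · subst hab
      simp
    · simpa [Matrix.updateRow_ne hab] using hg a b
  have hinv : ∀ i, Measurable fun x => ((F x)ᵀ * F x)⁻¹ j i := by
    intro i
    simp only [Matrix.inv_def, Ring.inverse_eq_inv', Matrix.smul_apply, smul_eq_mul]
    exact (hdet hg).inv.mul (hadj j i)
  have e : (fun x => leftInverse (F x) j p)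
      = fun x => ∑ i, ((F x)ᵀ * F x)⁻¹ j i * F x p i := by
    funext x
    rw [leftInverse, Matrix.mul_apply]
    rfl
  rw [e]
  exact Finset.measurable_sum _ fun i _ => (hinv i).mul (hF p i)

end LeastSquares

/-! ### Conditioning on some rows by resampling the others -/

section Resampling

/-- The family that agrees with `x` where `p` holds and with `y` elsewhere. -/
def mix {ι Ω : Type*} (p : ι → Prop) [DecidablePred p] (x y : ι → Ω) : ι → Ω :=
  fun i => if p i then x i else y i

/-- Replaces conditioning: the coordinates in `p` are frozen in `x`, the others are integrated over
an independent copy `y`. It suffices to compare boxes, whose preimages are products of boxes. -/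
theorem measurePreserving_mix {ι Ω : Type*} [Fintype ι] [MeasurableSpace Ω] (μ : Measure Ω)
    [IsProbabilityMeasure μ] (p : ι → Prop) [DecidablePred p] :
    MeasurePreserving (fun z : (ι → Ω) × (ι → Ω) => mix p z.1 z.2)
      ((Measure.pi fun _ => μ).prod (Measure.pi fun _ => μ)) (Measure.pi fun _ => μ) := by
  have hm : Measurable fun z : (ι → Ω) × (ι → Ω) => mix p z.1 z.2 := by
    refine measurable_pi_lambda _ fun i => ?_
    by_cases h : p i
    · simp only [mix, h, if_true]
      fun_prop
    · simp only [mix, h, if_false]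
      fun_prop
  refine ⟨hm, (Measure.pi_eq fun s hs => ?_).symm⟩
  rw [Measure.map_apply hm (MeasurableSet.univ_pi hs)]
  have e : (fun z : (ι → Ω) × (ι → Ω) => mix p z.1 z.2) ⁻¹' Set.univ.pi s
      = (Set.univ.pi fun i => if p i then s i else Set.univ) ×ˢ
        (Set.univ.pi fun i => if p i then Set.univ else s i) := by
    ext z
    simp only [Set.mem_preimage, Set.mem_pi, Set.mem_univ, true_implies, Set.mem_prod, mix]
    rw [← forall_and]
    refine forall_congr' fun i => ?_
    by_cases h : p i <;> simp [h]
  rw [e, Measure.prod_prod, Measure.pi_pi, Measure.pi_pi, ← Finset.prod_mul_distrib]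
  refine Finset.prod_congr rfl fun i _ => ?_
  by_cases h : p i <;> simp [h]

variable {d m : ℕ}

/-- The matrix whose rows are those of `x` where `p` holds and those of `y` elsewhere. -/
def mixRows (p : Fin d → Prop) [DecidablePred p] (x y : Matrix (Fin d) (Fin m) ℝ) :
    Matrix (Fin d) (Fin m) ℝ :=
  mix p x y

theorem mixRows_pos {p : Fin d → Prop} [DecidablePred p] (x y : Matrix (Fin d) (Fin m) ℝ)
    {i : Fin d} (h : p i) : mixRows p x y i = x i := if_pos h

theorem mixRows_neg {p : Fin d → Prop} [DecidablePred p] (x y : Matrix (Fin d) (Fin m) ℝ)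
    {i : Fin d} (h : ¬ p i) : mixRows p x y i = y i := if_neg h

theorem measurePreserving_mixRows (d m : ℕ) (p : Fin d → Prop) [DecidablePred p] :
    MeasurePreserving
      (fun z : Matrix (Fin d) (Fin m) ℝ × Matrix (Fin d) (Fin m) ℝ => mixRows p z.1 z.2)
      ((gaussianMatrix d m).prod (gaussianMatrix d m)) (gaussianMatrix d m) :=
  measurePreserving_mix (Measure.pi fun _ : Fin m => gaussianReal 0 1) p

theorem lintegral_gaussianMatrix_mixRows (p : Fin d → Prop) [DecidablePred p]
    {f : Matrix (Fin d) (Fin m) ℝ → ENNReal} (hf : Measurable f) :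
    ∫⁻ G, f G ∂gaussianMatrix d m
      = ∫⁻ x, ∫⁻ y, f (mixRows p x y) ∂gaussianMatrix d m ∂gaussianMatrix d m := by
  have h := measurePreserving_mixRows d m p
  rw [← h.lintegral_comp hf]
  exact lintegral_prod _ (hf.comp h.measurable).aemeasurable

theorem lintegral_gaussianMatrix_row (j : Fin d) {f : EuclideanSpace ℝ (Fin m) → ENNReal}
    (hf : Measurable f) :
    ∫⁻ G, f (WithLp.toLp 2 (G j)) ∂gaussianMatrix d m
      = ∫⁻ x, f x ∂stdGaussian (EuclideanSpace ℝ (Fin m)) := by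
  rw [← map_pi_eq_stdGaussian, lintegral_map hf (by fun_prop)]
  exact (measurePreserving_eval (fun _ : Fin d => Measure.pi fun _ : Fin m => gaussianReal 0 1)
    j).lintegral_comp (f := fun g => f (WithLp.toLp 2 g)) (by fun_prop)

theorem le_finrank_orthogonal_span {ι : Type*} (v : ι → EuclideanSpace ℝ (Fin m)) (s : Set ι)
    (t : Finset ι) (hst : s ⊆ t) :
    m ≤ Module.finrank ℝ (Submodule.span ℝ (v '' s))ᗮ + t.card := by
  have h := Submodule.finrank_add_finrank_orthogonal (Submodule.span ℝ (v '' s))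
  rw [finrank_euclideanSpace_fin] at h
  have h2 : Module.finrank ℝ (Submodule.span ℝ (v '' s)) ≤ t.card := by
    classical
    refine (Submodule.finrank_mono (Submodule.span_mono (Set.image_mono hst))).trans ?_
    rw [← Finset.coe_image]
    exact (finrank_span_finset_le_card _).trans Finset.card_image_le
  omega

/-- The projection of the row onto the orthogonal complement has a finite inverse second moment,
hence is almost surely nonzero. The margin `3` makes that moment finite. -/
theorem ae_row_notMem_span (j : Fin d) (v : Fin d → EuclideanSpace ℝ (Fin m))
    (t : Finset (Fin d)) (ht : t.card + 3 ≤ m) :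
    ∀ᵐ G ∂gaussianMatrix d m, WithLp.toLp 2 (G j) ∉ Submodule.span ℝ (v '' t) := by
  set K := (Submodule.span ℝ (v '' t))ᗮ with hK
  have hd := le_finrank_orthogonal_span v t t subset_rfl
  rw [← hK] at hd
  have hfm : Measurable fun x : EuclideanSpace ℝ (Fin m) =>
      (ENNReal.ofReal (‖K.starProjection x‖ ^ 2))⁻¹ := by fun_prop
  have h1 := lintegral_gaussianMatrix_row (d := d) j hfm
  rw [lintegral_inv_norm_sq_starProjection K (by omega)] at h1
  have hm : Measurable fun G : Matrix (Fin d) (Fin m) ℝ =>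
      (ENNReal.ofReal (‖K.starProjection (WithLp.toLp 2 (G j))‖ ^ 2))⁻¹ :=
    hfm.comp ((WithLp.measurable_toLp 2 _).comp (measurable_pi_apply j))
  have h2 := ae_lt_top (μ := gaussianMatrix d m) hm (by rw [h1]; exact ENNReal.ofReal_ne_top)
  filter_upwards [h2] with G hG hmem
  have : K.starProjection (WithLp.toLp 2 (G j)) = 0 := by
    rw [Submodule.starProjection_apply_eq_zero_iff, hK]
    exact Submodule.le_orthogonal_orthogonal _ hmem
  rw [this] at hG
  simp at hG

/-- Linear independence of a finite family is an open condition. -/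
theorem measurableSet_linearIndepOn (t : Set (Fin d)) :
    MeasurableSet {G : Matrix (Fin d) (Fin m) ℝ |
      LinearIndepOn ℝ (fun i => WithLp.toLp 2 (G i) : Fin d → EuclideanSpace ℝ (Fin m)) t} := by
  have hm : Measurable fun (G : Fin d → Fin m → ℝ) (i : t) =>
      (WithLp.toLp 2 (G i) : EuclideanSpace ℝ (Fin m)) := by fun_prop
  exact hm isOpen_setOfPred_linearIndependent.measurableSet

/-- Any few rows of a Gaussian matrix are almost surely linearly independent. -/
theorem ae_linearIndepOn (t : Finset (Fin d)) (ht : t.card + 2 ≤ m) :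
    ∀ᵐ G ∂gaussianMatrix d m,
      LinearIndepOn ℝ (fun i => WithLp.toLp 2 (G i) : Fin d → EuclideanSpace ℝ (Fin m)) t := by
  induction t using Finset.induction_on with
  | empty => simp
  | insert j t hj ih =>
    rw [Finset.card_insert_of_notMem hj] at ht
    -- Only row `j` is resampled: the fresh row almost surely avoids the span of the frozen rows
    -- indexed by `t`.
    have hmp := measurePreserving_mixRows d m (fun i : Fin d => i ≠ j)
    have hms := measurableSet_linearIndepOn (m := m) (↑(insert j t) : Set (Fin d))
    have key : ∀ᵐ z ∂(gaussianMatrix d m).prod (gaussianMatrix d m),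
        LinearIndepOn ℝ (fun i => WithLp.toLp 2 (mixRows (fun i : Fin d => i ≠ j) z.1 z.2 i) :
          Fin d → EuclideanSpace ℝ (Fin m)) (insert j t : Finset (Fin d)) := by
      refine (Measure.ae_prod_iff_ae_ae (hmp.measurable hms)).2 ?_
      filter_upwards [ih (by omega)] with x hx
      filter_upwards [ae_row_notMem_span j (fun i => WithLp.toLp 2 (x i)) t (by omega)] with y hy
      have he : Set.EqOn (fun i => WithLp.toLp 2 (mixRows (fun i : Fin d => i ≠ j) x y i))
          (fun i => WithLp.toLp 2 (x i) : Fin d → EuclideanSpace ℝ (Fin m)) t := by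
        intro i hi
        have : i ≠ j := fun e => hj (e ▸ hi)
        exact congrArg (WithLp.toLp 2) (mixRows_pos x y this)
      have hj' : mixRows (fun i : Fin d => i ≠ j) x y j = y j := mixRows_neg x y (by simp)
      change LinearIndepOn ℝ (fun i => WithLp.toLp 2 (mixRows (fun i : Fin d => i ≠ j) x y i) :
        Fin d → EuclideanSpace ℝ (Fin m)) (insert j t : Finset (Fin d))
      rw [Finset.coe_insert, linearIndepOn_insert (Finset.mem_coe.not.2 hj), he.image_eq,
        linearIndepOn_congr he, hj']
      exact ⟨hx, hy⟩
    have h := (ae_map_iff hmp.measurable.aemeasurable hms).2 key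
    rw [hmp.map_eq] at h
    exact h

variable (p : Fin d → Prop) [DecidablePred p]

/-- The transpose of the submatrix of `G` formed by the rows with index in `p`. -/
def selectedRows (G : Matrix (Fin d) (Fin m) ℝ) : Matrix (Fin m) {j // p j} ℝ :=
  (G.submatrix Subtype.val id)ᵀ

theorem measurable_leftInverse_selectedRows (j : {j // p j}) (q : Fin m) :
    Measurable fun G : Matrix (Fin d) (Fin m) ℝ => leftInverse (selectedRows p G) j q := by
  refine measurable_leftInverse_apply (F := fun G => selectedRows p G) (fun a b => ?_) j q
  have h : Measurable fun G : Fin d → Fin m → ℝ => G b.1 a := by fun_prop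
  exact h

theorem lintegral_sum_sq_leftInverse_le (hk : Fintype.card {j // p j} + 2 ≤ m)
    (j : {j // p j}) :
    ∫⁻ G : Matrix (Fin d) (Fin m) ℝ,
        ENNReal.ofReal (∑ q, leftInverse (selectedRows p G) j q ^ 2) ∂gaussianMatrix d m
      ≤ ENNReal.ofReal (1 / ((m : ℝ) - Fintype.card {j // p j} - 1)) := by
  have hmeas := measurable_leftInverse_selectedRows (m := m) p j
  -- All rows but the `j`-th are frozen, so the subspace `K` below depends on `x` only.
  rw [lintegral_gaussianMatrix_mixRows (fun i => i ≠ j.1) (by fun_prop)]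
  have hcard : 1 ≤ Fintype.card {j // p j} := Fintype.card_pos_iff.2 ⟨j⟩
  have hk' : (Fintype.card {j // p j} : ℝ) + 2 ≤ m := by exact_mod_cast hk
  have bound : ∀ x : Matrix (Fin d) (Fin m) ℝ,
      ∫⁻ y : Matrix (Fin d) (Fin m) ℝ, ENNReal.ofReal (∑ q,
          leftInverse (selectedRows p (mixRows (fun i => i ≠ j.1) x y)) j q ^ 2) ∂gaussianMatrix d m
        ≤ ENNReal.ofReal (1 / ((m : ℝ) - Fintype.card {j // p j} - 1)) := by
    intro x
    set v : {j // p j} → EuclideanSpace ℝ (Fin m) := fun i => WithLp.toLp 2 (x i) with hv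
    set K := (Submodule.span ℝ (v '' {j}ᶜ))ᗮ with hK
    have hd := le_finrank_orthogonal_span v {j}ᶜ (Finset.univ.erase j) (by intro; simp)
    rw [Finset.card_erase_of_mem (Finset.mem_univ _), Finset.card_univ, ← hK] at hd
    -- At most `k - 1` other columns are removed, so `K` has dimension at least `m - k + 1`; the
    -- inverse chi-squared mean then subtracts `2`.
    have hd' : (m : ℝ) + 1 ≤ Module.finrank ℝ K + Fintype.card {j // p j} := by
      have : m + 1 ≤ Module.finrank ℝ K + Fintype.card {j // p j} := by omega
      exact_mod_cast this
    calc _ ≤ ∫⁻ y : Matrix (Fin d) (Fin m) ℝ,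
          (ENNReal.ofReal (‖K.starProjection (WithLp.toLp 2 (y j))‖ ^ 2))⁻¹
            ∂gaussianMatrix d m := by
          refine lintegral_mono fun y => ?_
          refine (sum_sq_leftInverse_le _ j K ?_).trans (le_of_eq ?_)
          · rw [hK]
            congr 2
            refine Set.image_congr fun i hi => ?_
            have hi' : i.1 ≠ j.1 := fun e => hi (Subtype.ext e)
            have : mixRows (fun i => i ≠ j.1) x y i.1 = x i.1 := mixRows_pos x y hi'
            rw [hv]
            exact congrArg (WithLp.toLp 2) this.symm
          · have : mixRows (fun i => i ≠ j.1) x y j.1 = y j.1 := mixRows_neg x y (by simp)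
            rw [← this]
            rfl
      _ = ENNReal.ofReal (1 / ((Module.finrank ℝ K : ℝ) - 2)) := by
          rw [lintegral_gaussianMatrix_row (d := d) j.1
            (f := fun x => (ENNReal.ofReal (‖K.starProjection x‖ ^ 2))⁻¹) (by fun_prop),
            lintegral_inv_norm_sq_starProjection K (by omega)]
      _ ≤ _ := by
          refine ENNReal.ofReal_le_ofReal (one_div_le_one_div_of_le (by linarith) (by linarith))
  refine (lintegral_mono bound).trans ?_
  simp

end Resampling

/-! ### Expected excess error of one row -/

section RowError

variable {d m : ℕ} (p : Fin d → Prop) [DecidablePred p]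

/-- The contribution to the measurements of the entries of `a` outside the pattern `p`. -/
def offPatternNoise (a : Fin d → ℝ) (G : Matrix (Fin d) (Fin m) ℝ) : Fin m → ℝ :=
  fun q => ∑ l, (if p l then 0 else a l) * G l q

/-- The squared distance from the recovered row to the restriction of `a` to the pattern `p`, for
generic `G`. -/
noncomputable def rowExcess (a : Fin d → ℝ) (G : Matrix (Fin d) (Fin m) ℝ) : ℝ :=
  ∑ j, (leftInverse (selectedRows p G) *ᵥ offPatternNoise p a G) j ^ 2

theorem measurable_leftInverse_mulVec_noise (a : Fin d → ℝ) (j : {j // p j}) :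
    Measurable fun G : Matrix (Fin d) (Fin m) ℝ =>
      (leftInverse (selectedRows p G) *ᵥ offPatternNoise p a G) j := by
  have h := measurable_leftInverse_selectedRows (m := m) p j
  have hG : ∀ l q, Measurable fun G : Matrix (Fin d) (Fin m) ℝ => G l q := fun l q => by
    have h : Measurable fun G : Fin d → Fin m → ℝ => G l q := by fun_prop
    exact h
  simp only [Matrix.mulVec, dotProduct, offPatternNoise]
  fun_prop

theorem measurable_rowExcess (a : Fin d → ℝ) :
    Measurable fun G : Matrix (Fin d) (Fin m) ℝ => rowExcess p a G :=
  Finset.measurable_sum _ fun j _ => (measurable_leftInverse_mulVec_noise p a j).pow_const 2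

/-- Given the rows in `p`, the noise has independent centred entries of variance `∑ c_l ^ 2`. An
entry of the recovered deviation then has second moment `∑ c_l ^ 2` times the squared norm of a row
of the left inverse, and there are `k` such rows. -/
theorem lintegral_rowExcess_le (a : Fin d → ℝ) (hk : Fintype.card {j // p j} + 2 ≤ m) :
    ∫⁻ G : Matrix (Fin d) (Fin m) ℝ, ENNReal.ofReal (rowExcess p a G) ∂gaussianMatrix d m
      ≤ ENNReal.ofReal ((Fintype.card {j // p j} : ℝ) / ((m : ℝ) - Fintype.card {j // p j} - 1)
        * ∑ l, (if p l then 0 else a l) ^ 2) := by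
  have hk' : (Fintype.card {j // p j} : ℝ) + 2 ≤ m := by exact_mod_cast hk
  have hB := measurable_leftInverse_selectedRows (m := m) p
  set c : Fin d → ℝ := fun l => if p l then 0 else a l with hc
  have hentry : ∀ j : {j // p j},
      ∫⁻ G : Matrix (Fin d) (Fin m) ℝ, ENNReal.ofReal
        ((leftInverse (selectedRows p G) *ᵥ offPatternNoise p a G) j ^ 2) ∂gaussianMatrix d m
      ≤ ENNReal.ofReal ((∑ l, c l ^ 2) * (1 / ((m : ℝ) - Fintype.card {j // p j} - 1))) := by
    intro j
    have hm := measurable_leftInverse_mulVec_noise (m := m) p a j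
    rw [lintegral_gaussianMatrix_mixRows p (by fun_prop)]
    have hin : ∀ x : Matrix (Fin d) (Fin m) ℝ,
        ∫⁻ y : Matrix (Fin d) (Fin m) ℝ, ENNReal.ofReal
          ((leftInverse (selectedRows p (mixRows p x y)) *ᵥ
            offPatternNoise p a (mixRows p x y)) j ^ 2) ∂gaussianMatrix d m
        = ENNReal.ofReal (∑ l, c l ^ 2)
          * ENNReal.ofReal (∑ q, leftInverse (selectedRows p x) j q ^ 2) := by
      intro x
      rw [← ENNReal.ofReal_mul (Finset.sum_nonneg fun _ _ => sq_nonneg _), Finset.sum_mul_sum]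
      simp_rw [← mul_pow]
      rw [← lintegral_sq_linear_gaussianMatrix]
      refine lintegral_congr fun y => ?_
      have h1 : selectedRows p (mixRows p x y) = selectedRows p x := by
        ext q i
        exact congrFun (mixRows_pos x y i.2) q
      -- The coefficients vanish on `p`, so the noise involves only the resampled rows.
      have h2 : offPatternNoise p a (mixRows p x y) = fun q => ∑ l, c l * y l q := by
        funext q
        refine Finset.sum_congr rfl fun l _ => ?_
        by_cases h : p l
        · simp [hc, h]
        · rw [mixRows_neg x y h]
      rw [h1, h2]
      congr 2
      simp only [Matrix.mulVec, dotProduct, Finset.mul_sum]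
      rw [Finset.sum_comm]
      exact Finset.sum_congr rfl fun l _ => Finset.sum_congr rfl fun q _ => by ring
    simp_rw [hin]
    have hBj := hB j
    rw [lintegral_const_mul _ (by fun_prop),
      ENNReal.ofReal_mul (Finset.sum_nonneg fun _ _ => sq_nonneg _)]
    gcongr
    exact lintegral_sum_sq_leftInverse_le p hk j
  simp only [rowExcess, ENNReal.ofReal_sum_of_nonneg (fun _ _ => sq_nonneg _)]
  rw [lintegral_finsetSum _ fun j _ =>
    ((measurable_leftInverse_mulVec_noise p a j).pow_const 2).ennreal_ofReal]
  refine (Finset.sum_le_sum fun j _ => hentry j).trans (le_of_eq ?_)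
  rw [Finset.sum_const, Finset.card_univ, ← ENNReal.ofReal_nsmul, nsmul_eq_mul]
  congr 1
  ring

end RowError

/-! ### Error of the recovered matrix and Markov's inequality -/

section Recovery

variable {n d m s : ℕ} {S A : Matrix (Fin n) (Fin d) ℝ}

theorem IsRowSparsePattern.card_le (hS : IsRowSparsePattern s S) (i : Fin n) :
    Fintype.card {j // S i j = 1} ≤ s := by
  rw [Fintype.card_subtype]
  refine (Finset.card_le_card fun j hj => ?_).trans (hS.2 i)
  simp only [Finset.mem_filter, Finset.mem_univ, true_and] at hj ⊢
  rw [hj]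
  exact one_ne_zero

theorem IsRowSparsePattern.hadamard_apply (hS : IsRowSparsePattern s S)
    (B : Matrix (Fin n) (Fin d) ℝ) (i : Fin n) (j : Fin d) :
    (S ⊙ B) i j = if S i j = 1 then B i j else 0 := by
  rw [Matrix.hadamard_apply]
  rcases hS.1 i j with h | h <;> simp [h]

theorem recoverRows_eq_hadamard (hS : IsRowSparsePattern s S) (G : Matrix (Fin d) (Fin m) ℝ)
    (Z : Matrix (Fin n) (Fin m) ℝ) : recoverRows S G Z = S ⊙ recoverRows S G Z := by
  ext i j
  rw [hS.hadamard_apply]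
  by_cases h : S i j = 1 <;> simp [recoverRows, h]

theorem frobenius_norm_sq (B : Matrix (Fin n) (Fin d) ℝ) : ‖B‖ ^ 2 = ∑ i, ∑ j, B i j ^ 2 := by
  rw [Matrix.frobenius_norm_def, ← Real.sqrt_eq_rpow, Real.sq_sqrt (by positivity)]
  simp

theorem IsRowSparsePattern.norm_sub_hadamard_sq (hS : IsRowSparsePattern s S)
    (A : Matrix (Fin n) (Fin d) ℝ) :
    ‖A - S ⊙ A‖ ^ 2 = ∑ i, ∑ j, (if S i j = 1 then 0 else A i j) ^ 2 := by
  rw [frobenius_norm_sq]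
  refine Finset.sum_congr rfl fun i _ => Finset.sum_congr rfl fun j _ => ?_
  rw [Matrix.sub_apply, hS.hadamard_apply]
  by_cases h : S i j = 1 <;> simp [h]

theorem mul_row_eq (p : Fin d → Prop) [DecidablePred p] (A : Matrix (Fin n) (Fin d) ℝ)
    (G : Matrix (Fin d) (Fin m) ℝ) (i : Fin n) :
    (A * G) i = selectedRows p G *ᵥ (fun j => A i j.1) + offPatternNoise p (A i) G := by
  funext q
  simp only [Matrix.mul_apply, Pi.add_apply, Matrix.mulVec, dotProduct, selectedRows,
    Matrix.transpose_apply, Matrix.submatrix_apply, id, offPatternNoise]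
  rw [← Fintype.sum_subtype_add_sum_subtype p (fun l => A i l * G l q),
    ← Fintype.sum_subtype_add_sum_subtype p (fun l => (if p l then 0 else A i l) * G l q)]
  have h1 : ∑ l : {l // p l}, (if p l.1 then 0 else A i l.1) * G l.1 q = 0 :=
    Finset.sum_eq_zero fun l _ => by simp [l.2]
  rw [h1, zero_add]
  congr 1
  · exact Finset.sum_congr rfl fun l _ => mul_comm _ _
  · exact Finset.sum_congr rfl fun l _ => by rw [if_neg l.2]

/-- Each group of rows of `G` selected by a row of the pattern `S` is linearly independent. -/
def HasIndepRows (S : Matrix (Fin n) (Fin d) ℝ) (G : Matrix (Fin d) (Fin m) ℝ) : Prop :=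
  ∀ i, LinearIndepOn ℝ (fun j => WithLp.toLp 2 (G j) : Fin d → EuclideanSpace ℝ (Fin m))
    {j | S i j = 1}

theorem ae_hasIndepRows (hS : IsRowSparsePattern s S) (hm : s + 2 ≤ m) :
    ∀ᵐ G ∂gaussianMatrix d m, HasIndepRows S G := by
  refine ae_all_iff.2 fun i => ?_
  have hc := hS.card_le i
  rw [Fintype.card_subtype] at hc
  have h := ae_linearIndepOn (m := m) (Finset.univ.filter fun j => S i j = 1) (by omega)
  simpa using h

/-- The squared distance from the recovered matrix to `S ⊙ A`, for generic `G`. -/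
noncomputable def excess (S A : Matrix (Fin n) (Fin d) ℝ) (G : Matrix (Fin d) (Fin m) ℝ) : ℝ :=
  ∑ i, rowExcess (fun j => S i j = 1) (A i) G

theorem recoverRows_apply {G : Matrix (Fin d) (Fin m) ℝ} (hG : HasIndepRows S G) (i : Fin n)
    (j : {j // S i j = 1}) :
    recoverRows S G (A * G) i j.1 = A i j.1 + (leftInverse (selectedRows (fun j => S i j = 1) G) *ᵥ
      offPatternNoise (fun j => S i j = 1) (A i) G) j := by
  have hu : IsUnit ((selectedRows (fun j => S i j = 1) G)ᵀ
      * selectedRows (fun j => S i j = 1) G).det := (isUnit_det_gram_iff _).2 (hG i)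
  have h1 : recoverRows S G (A * G) i j.1
      = (pinv (selectedRows (fun j => S i j = 1) G) *ᵥ (A * G) i) j := by
    simp only [recoverRows, Matrix.of_apply, dif_pos j.2]
    rfl
  rw [h1, mul_row_eq (fun j => S i j = 1), pinv_eq_of_isUnit_det hu, Matrix.mulVec_add,
    Matrix.mulVec_mulVec, leftInverse_mul_self hu, Matrix.one_mulVec, Pi.add_apply]

/-- The two error contributions have disjoint supports: off the pattern the residual is that of `S ⊙
A`, on the pattern it is the image of the noise. -/
theorem norm_sub_recoverRows_sq (hS : IsRowSparsePattern s S) {G : Matrix (Fin d) (Fin m) ℝ}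
    (hG : HasIndepRows S G) :
    ‖A - recoverRows S G (A * G)‖ ^ 2 = ‖A - S ⊙ A‖ ^ 2 + excess S A G := by
  rw [hS.norm_sub_hadamard_sq, frobenius_norm_sq, excess, ← Finset.sum_add_distrib]
  refine Finset.sum_congr rfl fun i _ => ?_
  rw [← Fintype.sum_subtype_add_sum_subtype (fun j => S i j = 1)
      (fun j => (A - recoverRows S G (A * G)) i j ^ 2),
    ← Fintype.sum_subtype_add_sum_subtype (fun j => S i j = 1)
      (fun j => (if S i j = 1 then 0 else A i j) ^ 2), add_comm]
  have h1 : ∑ j : {j // S i j = 1}, (if S i j.1 = 1 then 0 else A i j.1) ^ 2 = 0 :=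
    Finset.sum_eq_zero fun j _ => by simp [j.2]
  rw [h1, zero_add]
  congr 1
  · refine Finset.sum_congr rfl fun j _ => ?_
    simp [recoverRows, j.2]
  · refine Finset.sum_congr rfl fun j _ => ?_
    rw [Matrix.sub_apply, recoverRows_apply hG]
    ring

theorem measurable_excess : Measurable fun G : Matrix (Fin d) (Fin m) ℝ => excess S A G :=
  Finset.measurable_sum _ fun _ _ => measurable_rowExcess _ _

theorem rowExcess_nonneg (p : Fin d → Prop) [DecidablePred p] (a : Fin d → ℝ)
    (G : Matrix (Fin d) (Fin m) ℝ) : 0 ≤ rowExcess p a G :=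
  Finset.sum_nonneg fun _ _ => sq_nonneg _

theorem excess_eq_zero (hA : A = S ⊙ A) (G : Matrix (Fin d) (Fin m) ℝ)
    (hS : IsRowSparsePattern s S) : excess S A G = 0 := by
  refine Finset.sum_eq_zero fun i _ => Finset.sum_eq_zero fun j _ => ?_
  have : offPatternNoise (fun j => S i j = 1) (A i) G = 0 := by
    funext q
    refine Finset.sum_eq_zero fun l _ => ?_
    by_cases h : S i l = 1
    · simp [h]
    · have : A i l = 0 := by rw [hA, hS.hadamard_apply, if_neg h]
      simp [this]
  rw [this, Matrix.mulVec_zero]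
  simp

theorem lintegral_excess_le (hS : IsRowSparsePattern s S) (hm : s + 2 ≤ m) :
    ∫⁻ G : Matrix (Fin d) (Fin m) ℝ, ENNReal.ofReal (excess S A G) ∂gaussianMatrix d m
      ≤ ENNReal.ofReal ((s : ℝ) / ((m : ℝ) - s - 1) * ‖A - S ⊙ A‖ ^ 2) := by
  have hm' : (s : ℝ) + 2 ≤ m := by exact_mod_cast hm
  have hpos : 0 ≤ (s : ℝ) / ((m : ℝ) - s - 1) := div_nonneg (by positivity) (by linarith)
  rw [hS.norm_sub_hadamard_sq, Finset.mul_sum, ENNReal.ofReal_sum_of_nonneg fun i _ =>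
    mul_nonneg hpos (Finset.sum_nonneg fun _ _ => sq_nonneg _)]
  have e : ∀ G : Matrix (Fin d) (Fin m) ℝ, ENNReal.ofReal (excess S A G)
      = ∑ i, ENNReal.ofReal (rowExcess (fun j => S i j = 1) (A i) G) := fun G =>
    ENNReal.ofReal_sum_of_nonneg fun _ _ => rowExcess_nonneg _ _ _
  simp_rw [e]
  refine (lintegral_finsetSum _ fun i _ =>
    (measurable_rowExcess (fun j => S i j = 1) (A i)).ennreal_ofReal).le.trans ?_
  refine Finset.sum_le_sum fun i _ => ?_
  have hc := hS.card_le i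
  have hc' : (Fintype.card {j // S i j = 1} : ℝ) ≤ s := by exact_mod_cast hc
  refine (lintegral_rowExcess_le (fun j => S i j = 1) (A i) (by omega)).trans ?_
  refine ENNReal.ofReal_le_ofReal (mul_le_mul_of_nonneg_right ?_
    (Finset.sum_nonneg fun _ _ => sq_nonneg _))
  -- `k / (m - k - 1)` increases with `k`, so `k ≤ s` gives a bound uniform in the rows.
  exact div_le_div₀ (by positivity) hc' (by linarith) (by linarith)

theorem measure_error_ge_le (hS : IsRowSparsePattern s S) {ε δ : ℝ} (hε : 0 < ε) (hδ : 0 < δ)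
    (hm : s + 2 ≤ m) (hm' : (s : ℝ) * (1 / (2 * δ * ε) + 1) + 1 ≤ m) (hA : A ≠ S ⊙ A) :
    gaussianMatrix d m {G | ‖A - recoverRows S G (A * G)‖ ≥ (1 + ε) * ‖A - S ⊙ A‖}
      ≤ ENNReal.ofReal δ := by
  have hρ : 0 < ‖A - S ⊙ A‖ := norm_pos_iff.2 (sub_ne_zero.2 hA)
  have hρ2 : 0 < 2 * ε * ‖A - S ⊙ A‖ ^ 2 := by positivity
  have hsub : gaussianMatrix d m
        {G | ‖A - recoverRows S G (A * G)‖ ≥ (1 + ε) * ‖A - S ⊙ A‖}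
      ≤ gaussianMatrix d m {G | ENNReal.ofReal (2 * ε * ‖A - S ⊙ A‖ ^ 2)
          ≤ ENNReal.ofReal (excess S A G)} := by
    -- The inclusion holds only where the selected rows are independent. The failure event need not
    -- be shown measurable; Markov is applied to the event for `excess`.
    refine measure_mono_ae ?_
    filter_upwards [ae_hasIndepRows hS hm] with G hG hbad
    have hbad' : (1 + ε) * ‖A - S ⊙ A‖ ≤ ‖A - recoverRows S G (A * G)‖ := hbad
    refine ENNReal.ofReal_le_ofReal ?_
    have h1 := pow_le_pow_left₀ (by positivity) hbad' 2
    rw [norm_sub_recoverRows_sq hS hG] at h1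
    -- `(1 + ε) ^ 2 ≥ 1 + 2 * ε`; this is the source of the factor `2` in the query bound.
    nlinarith [sq_nonneg (ε * ‖A - S ⊙ A‖)]
  have hm2 : (s : ℝ) + 2 ≤ m := by exact_mod_cast hm
  have hratio : (s : ℝ) / ((m : ℝ) - s - 1) ≤ 2 * δ * ε := by
    rw [div_le_iff₀ (by linarith)]
    have h1 : (s : ℝ) * (1 / (2 * δ * ε)) ≤ m - s - 1 := by linarith
    rw [mul_one_div, div_le_iff₀ (by positivity)] at h1
    linarith
  refine hsub.trans ((meas_ge_le_lintegral_div measurable_excess.ennreal_ofReal.aemeasurable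
    (by simpa using hρ2) ENNReal.ofReal_ne_top).trans ?_)
  refine ENNReal.div_le_of_le_mul ((lintegral_excess_le hS hm).trans ?_)
  rw [← ENNReal.ofReal_mul hδ.le]
  refine ENNReal.ofReal_le_ofReal ?_
  calc _ ≤ 2 * δ * ε * ‖A - S ⊙ A‖ ^ 2 := by gcongr
    _ = _ := by ring

theorem measure_not_isNearOptimal_le (hS : IsRowSparsePattern s S) {ε δ : ℝ} (hε : 0 < ε)
    (hδ : 0 < δ) (hm : s + 2 ≤ m) (hm' : (s : ℝ) * (1 / (2 * δ * ε) + 1) + 1 ≤ m) :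
    gaussianMatrix d m {G | ¬ IsNearOptimal S A ε (recoverRows S G (A * G))}
      ≤ ENNReal.ofReal δ := by
  by_cases hA : A = S ⊙ A
  -- With zero optimal error Markov's threshold degenerates, but the noise vanishes and recovery is
  -- almost surely exact.
  · refine le_of_eq_of_le (measure_eq_zero_iff_ae_notMem.2 ?_) zero_le
    filter_upwards [ae_hasIndepRows hS hm] with G hG hbad
    refine hbad ⟨recoverRows_eq_hadamard hS G _, ?_⟩
    have h := norm_sub_recoverRows_sq (A := A) hS hG
    rw [excess_eq_zero hA G hS, add_zero] at h
    rw [(pow_left_inj₀ (norm_nonneg _) (norm_nonneg _) two_ne_zero).1 h]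
    nlinarith [norm_nonneg (A - S ⊙ A)]
  · refine (measure_mono fun G hbad => ?_).trans (measure_error_ge_le hS hε hδ hm hm' hA)
    by_contra hlt
    exact hbad ⟨recoverRows_eq_hadamard hS G _, (not_le.1 hlt).le⟩

theorem IsRowSparsePattern.eq_zero (hS : IsRowSparsePattern 0 S) : S = 0 := by
  ext i j
  have h := Finset.card_eq_zero.1 (Nat.le_zero.1 (hS.2 i))
  by_contra hne
  have : j ∈ Finset.univ.filter (fun j => S i j ≠ 0) := by simpa using hne
  rw [h] at this
  exact absurd this (Finset.notMem_empty j)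

theorem recoverRows_zero (G : Matrix (Fin d) (Fin m) ℝ) (Z : Matrix (Fin n) (Fin m) ℝ) :
    recoverRows 0 G Z = 0 := by
  ext i j
  simp [recoverRows]

theorem isNearOptimal_recoverRows_zero {ε : ℝ} (hε : 0 < ε) (G : Matrix (Fin d) (Fin m) ℝ)
    (Z : Matrix (Fin n) (Fin m) ℝ) : IsNearOptimal 0 A ε (recoverRows 0 G Z) := by
  rw [recoverRows_zero]
  refine ⟨by simp, ?_⟩
  rw [Matrix.zero_hadamard]
  nlinarith [norm_nonneg (A - 0)]

/-- For `s ≠ 0` the bound gives `m > s + 1` strictly. For `s = 0` it allows `m = 1`, where the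
moment bounds are unavailable, so that case is treated separately. -/
theorem add_two_le_of_bound {ε δ : ℝ} (hε : 0 < ε) (hδ : 0 < δ) (hs : s ≠ 0)
    (hm : (s : ℝ) * (1 / (2 * δ * ε) + 1) + 1 ≤ m) : s + 2 ≤ m := by
  have hs' : (0 : ℝ) < s := by exact_mod_cast Nat.pos_of_ne_zero hs
  have h : 0 < (s : ℝ) * (1 / (2 * δ * ε)) := by positivity
  have : ((s + 1 : ℕ) : ℝ) < m := by
    push_cast
    linarith
  have := Nat.cast_lt.1 this
  omega

end Recovery

end FixedSparsity

theorem corollary2 :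
    -- the probability bound, with explicit number of queries
    (∀ (n d s m : ℕ) (A S : Matrix (Fin n) (Fin d) ℝ),
      FixedSparsity.IsRowSparsePattern s S →
      ∀ ε δ : ℝ, 0 < ε → 0 < δ → δ < 1 →
      (s : ℝ) * (1 / (2 * δ * ε) + 1) + 1 ≤ (m : ℝ) →
        (A ≠ S ⊙ A →
          (FixedSparsity.fixedSparseRecovery S m).queryLaw
            {G | ‖A - (FixedSparsity.fixedSparseRecovery S m).run A G‖
                  ≥ (1 + ε) * ‖A - S ⊙ A‖} ≤ ENNReal.ofReal δ) ∧
        (FixedSparsity.fixedSparseRecovery S m).queryLaw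
            {G | ¬ FixedSparsity.IsNearOptimal S A ε
                  ((FixedSparsity.fixedSparseRecovery S m).run A G)} ≤ ENNReal.ofReal δ) ∧
    -- `O(s / ε)` queries suffice for every fixed failure probability `δ`
    (∀ δ : ℝ, 0 < δ → δ < 1 →
      ∃ C : ℝ, 0 < C ∧ ∀ (s : ℕ) (ε : ℝ), 0 < ε → ε ≤ 1 →
        ∃ m₀ : ℕ, (m₀ : ℝ) ≤ C * ((s : ℝ) / ε) ∧
          ∀ m : ℕ, m₀ ≤ m → ∀ (n d : ℕ) (A S : Matrix (Fin n) (Fin d) ℝ),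
            FixedSparsity.IsRowSparsePattern s S →
            (FixedSparsity.fixedSparseRecovery S m).queryLaw
              {G | ¬ FixedSparsity.IsNearOptimal S A ε
                    ((FixedSparsity.fixedSparseRecovery S m).run A G)} ≤ ENNReal.ofReal δ) := by
  have hzero : ∀ {n d m : ℕ} (A S : Matrix (Fin n) (Fin d) ℝ) (ε δ : ℝ), 0 < ε →
      FixedSparsity.IsRowSparsePattern 0 S →
      (FixedSparsity.fixedSparseRecovery S m).queryLaw
        {G | ¬ FixedSparsity.IsNearOptimal S A ε
          ((FixedSparsity.fixedSparseRecovery S m).run A G)} ≤ ENNReal.ofReal δ := by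
    intro n d m A S ε δ hε hS
    obtain rfl := hS.eq_zero
    refine le_of_eq_of_le (measure_mono_null (t := ∅) (fun G hG => hG ?_) measure_empty) zero_le
    exact FixedSparsity.isNearOptimal_recoverRows_zero hε G _
  refine ⟨fun n d s m A S hS ε δ hε hδ _ hm => ?_, fun δ hδ _ => ?_⟩
  · rcases eq_or_ne s 0 with rfl | hs
    · refine ⟨fun hA => ?_, hzero A S ε δ hε hS⟩
      obtain rfl := hS.eq_zero
      refine le_of_eq_of_le (measure_mono_null (t := ∅) (fun G hG => ?_) measure_empty) zero_le
      have hG' : (1 + ε) * ‖A - 0 ⊙ A‖ ≤ ‖A - FixedSparsity.recoverRows 0 G (A * G)‖ := hG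
      rw [FixedSparsity.recoverRows_zero, Matrix.zero_hadamard] at hG'
      rw [Matrix.zero_hadamard] at hA
      have : 0 < ‖A - 0‖ := norm_pos_iff.2 (sub_ne_zero.2 hA)
      nlinarith
    · have hm2 := FixedSparsity.add_two_le_of_bound hε hδ hs hm
      exact ⟨FixedSparsity.measure_error_ge_le hS hε hδ hm2 hm,
        FixedSparsity.measure_not_isNearOptimal_le hS hε hδ hm2 hm⟩
  -- The `3` pays for the summand `s`, the final `1` and the rounding up; each is at most `s / ε`
  -- when `s ≥ 1` and `ε ≤ 1`.
  · refine ⟨1 / (2 * δ) + 3, by positivity, fun s ε hε hε1 => ?_⟩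
    rcases eq_or_ne s 0 with rfl | hs
    -- For `s = 0` the bound forces `m₀ = 0`; the zero output is already optimal without any query.
    · exact ⟨0, by simp, fun m _ n d A S hS => hzero A S ε δ hε hS⟩
    · refine ⟨⌈(s : ℝ) * (1 / (2 * δ * ε) + 1) + 1⌉₊, ?_, fun m hm n d A S hS => ?_⟩
      · have hs1 : (1 : ℝ) ≤ s := by exact_mod_cast Nat.one_le_iff_ne_zero.2 hs
        have hse : (s : ℝ) ≤ s / ε := le_div_self (by positivity) hε hε1
        have e : (1 / (2 * δ) + 3) * ((s : ℝ) / ε)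
            = s * (1 / (2 * δ * ε)) + 3 * (s / ε) := by
          field_simp
        have := Nat.ceil_lt_add_one (a := (s : ℝ) * (1 / (2 * δ * ε) + 1) + 1) (by positivity)
        rw [e]
        linarith
      · have hm' := Nat.ceil_le.1 hm
        exact FixedSparsity.measure_not_isNearOptimal_le hS hε hδ
          (FixedSparsity.add_two_le_of_bound hε hδ hs hm') hm'
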